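/- Let $(R,\mathfrak m)$ be a Cohen–Macaulay (commutative Noetherian) local ring, and let $M$ be a maximal Cohen–Macaulay $R$-module, i.e. a finitely generated module with $\operatorname{depth} M=\dim M=\dim R$. For $n\ge 0$ let $\Omega_n^R(M)$ be the $n$th syzygy module of $M$, i.e. the image of the $n$th differential of an augmented minimal free resolution $\cdots\to F_1\to F_0\to M\to 0$ of $M$ (the $0$th differential being $F_0\to M$, and $F_n\to F_{n-1}$ being the $n$th for $n\ge 1$). Let $n_1,\dots,n_r\ge 1$ be integers, not necessarily distinct, and let $L\neq 0$ be an $R$-module for which there is a surjective $R$-linear map $$\bigoplus_{i=1}^{r}\Omega_{n_i}^R(M)\longrightarrow L .$$ Then $L$ is not a semidualizing $R$-module; here a finitely generated $R$-module $C$ is called semidualizing if the homothety map $R\to\operatorname{Hom}_R(C,C)$ is an isomorphism and $\operatorname{Ext}^i_R(C,C)=0$ for all $i\ge 1$. Moreover, $L$ is not free, and $L$ is not a maximal Cohen–Macaulay $R$-module of finite injective dimension. -/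

import Mathlib

open CategoryTheory DirectSum

universe u

noncomputable section

/-- The depth of a module `M` over a local ring: the supremum of the lengths of the `M`-regular
sequences contained in the maximal ideal. -/
def moduleDepth (R : Type u) [CommRing R] [IsLocalRing R]
    (M : Type u) [AddCommGroup M] [Module R M] : ℕ∞ :=
  ⨆ (rs : List R) (_ : ∀ r ∈ rs, r ∈ IsLocalRing.maximalIdeal R)
    (_ : RingTheory.Sequence.IsRegular M rs), (rs.length : ℕ∞)

/-- A Cohen-Macaulay local ring: Noetherian local with `depth R = dim R`. -/
structure IsCohenMacaulayLocal (R : Type u) [CommRing R] [IsLocalRing R] : Prop where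
  noetherian : IsNoetherianRing R
  depth_eq : (moduleDepth R R : WithBot ℕ∞) = ringKrullDim R

/-- A maximal Cohen-Macaulay module: finitely generated with `depth M = dim M = dim R`.
The zero module is excluded, since its support has dimension `⊥`. -/
structure IsMaximalCohenMacaulay (R : Type u) [CommRing R] [IsLocalRing R]
    (M : Type u) [AddCommGroup M] [Module R M] : Prop where
  finite : Module.Finite R M
  depth_eq : (moduleDepth R M : WithBot ℕ∞) = Module.supportDim R M
  dim_eq : Module.supportDim R M = ringKrullDim R

/-- A semidualizing module: finitely generated, the homothety map `R → Hom_R(M, M)` is an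
isomorphism, and `Ext^i_R(M, M) = 0` for all `i ≥ 1`. -/
structure IsSemidualizing (R : Type u) [CommRing R]
    (M : Type u) [AddCommGroup M] [Module R M] : Prop where
  finite : Module.Finite R M
  homothety_bijective : Function.Bijective (LinearMap.lsmul R M)
  ext_eq_zero : ∀ i : ℕ, 1 ≤ i →
    Subsingleton (Abelian.Ext (ModuleCat.of R M) (ModuleCat.of R M) i)

/-- Finite injective dimension. -/
def HasFiniteInjectiveDimension (R : Type u) [CommRing R]
    (M : Type u) [AddCommGroup M] [Module R M] : Prop :=
  ∃ n : ℕ, HasInjectiveDimensionLE (ModuleCat.of R M) n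

/-- An augmented minimal free resolution
`⋯ → R^(rank 2) → R^(rank 1) → R^(rank 0) → M → 0` of a module over a local ring, where
`d n : R^(rank (n + 1)) → R^(rank n)`; minimality means that every differential `d n` has image
inside the maximal ideal times its target. -/
structure MinimalFreeResolution (R : Type u) [CommRing R] [IsLocalRing R]
    (M : Type u) [AddCommGroup M] [Module R M] where
  rank : ℕ → ℕ
  d : ∀ n : ℕ, (Fin (rank (n + 1)) → R) →ₗ[R] (Fin (rank n) → R)
  aug : (Fin (rank 0) → R) →ₗ[R] M
  aug_surjective : Function.Surjective aug
  exact_aug : Function.Exact (d 0) aug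
  exact_d : ∀ n : ℕ, Function.Exact (d (n + 1)) (d n)
  minimal : ∀ n : ℕ, LinearMap.range (d n) ≤
    IsLocalRing.maximalIdeal R • (⊤ : Submodule R (Fin (rank n) → R))

/-- The `n`th syzygy module: the image of the `n`th differential of the augmented minimal free
resolution, the `0`th differential being the augmentation and the `(n + 1)`st one being `d n`. -/
def MinimalFreeResolution.syzygy {R : Type u} [CommRing R] [IsLocalRing R]
    {M : Type u} [AddCommGroup M] [Module R M] (F : MinimalFreeResolution R M) :
    ℕ → ModuleCat.{u} R
  | 0 => ModuleCat.of R (LinearMap.range F.aug)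
  | n + 1 => ModuleCat.of R (LinearMap.range (F.d n))

end

open CategoryTheory.Abelian Pointwise RingTheory.Sequence

/-! ### Vanishing of `Ext` along short exact sequences and modulo a regular element -/

section ExtVanishing

variable {R : Type u} [CommRing R]

/-! Write `k` for the residue field and `d = dim R`. Choose a sequence `rs` of length `d` in the
maximal ideal `𝔪` that is regular on `R` and `M` and, where needed, on `L`. Then `R/(rs)` is a
nonzero Artinian ring, so it has a nonzero socle element, represented by some `s`. The syzygies of
`M` inherit regularity of `rs`, so `0 → Ω (n + 1) → F n → Ω n → 0` stays exact modulo `rs`. By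
minimality `Ω (n + 1)/(rs)` then embeds in `𝔪 F n/(rs)`, which `s` kills. Hence `s` kills `L/(rs)L`
(`MinimalFreeResolution.exists_socle_smul_mem`), so `L/(rs)L` is not faithful over `R/(rs)`. Each of
the three properties of `L` contradicts this.

Free: a nonzero free module stays faithful modulo any ideal (`mem_of_forall_smul_mem_of_free`).

Semidualizing: since `Hom(L, L) ≅ R` and the higher `Ext(L, L)` vanish, the depth of `L` is at least
that of `R`, so `rs` may be taken regular on `L`. Multiplication by `s` maps `L` into `(rs)L`, and
`Ext` vanishing puts it in `(rs) Hom(L, L)`, which forces `s ∈ (rs)`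
(`IsSemidualizing.mem_of_forall_smul_mem`).

Maximal Cohen–Macaulay of finite injective dimension: `Ext^(d+1)(-, L)` vanishes on finite length
modules, so an embedding `k → L/(rs)L` extends along the map `k → R/(rs)` sending `1` to `s`. The
image of `1` is then a multiple of `s`, hence zero
(`HasFiniteInjectiveDimension.exists_smul_notMem`). -/

theorem CategoryTheory.ShortComplex.ShortExact.subsingleton_ext_X₃
    {S : ShortComplex (ModuleCat.{u} R)} (hS : S.ShortExact) (X : ModuleCat.{u} R) (i : ℕ)
    (h₂ : Subsingleton (Ext X S.X₂ i))
    (h₁ : Subsingleton (Ext X S.X₁ (i + 1))) : Subsingleton (Ext X S.X₃ i) := by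
  refine subsingleton_of_forall_eq 0 fun e => ?_
  obtain ⟨y, hy⟩ := Ext.covariant_sequence_exact₃ X hS e rfl (Subsingleton.elim _ _)
  rw [← hy, Subsingleton.elim y 0, Ext.zero_comp]

theorem CategoryTheory.ShortComplex.ShortExact.subsingleton_ext_X₂
    {S : ShortComplex (ModuleCat.{u} R)} (hS : S.ShortExact) (X : ModuleCat.{u} R) (i : ℕ)
    (h₁ : Subsingleton (Ext X S.X₁ i))
    (h₃ : Subsingleton (Ext X S.X₃ i)) : Subsingleton (Ext X S.X₂ i) := by
  refine subsingleton_of_forall_eq 0 fun e => ?_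
  obtain ⟨y, hy⟩ := Ext.covariant_sequence_exact₂ X hS e (Subsingleton.elim _ _)
  rw [← hy, Subsingleton.elim y 0, Ext.zero_comp]

theorem CategoryTheory.ShortComplex.ShortExact.subsingleton_ext_X₂_left
    {S : ShortComplex (ModuleCat.{u} R)}
    (hS : S.ShortExact) (Y : ModuleCat.{u} R) (i : ℕ) (h₁ : Subsingleton (Ext S.X₁ Y i))
    (h₃ : Subsingleton (Ext S.X₃ Y i)) : Subsingleton (Ext S.X₂ Y i) := by
  refine subsingleton_of_forall_eq 0 fun e => ?_
  obtain ⟨y, hy⟩ := Ext.contravariant_sequence_exact₂ hS Y e (Subsingleton.elim _ _)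
  rw [← hy, Subsingleton.elim y 0, Ext.comp_zero]

theorem CategoryTheory.ShortComplex.ShortExact.subsingleton_ext_X₁_left
    {S : ShortComplex (ModuleCat.{u} R)}
    (hS : S.ShortExact) (Y : ModuleCat.{u} R) (i : ℕ) (h₂ : Subsingleton (Ext S.X₂ Y i))
    (h₃ : Subsingleton (Ext S.X₃ Y (i + 1))) : Subsingleton (Ext S.X₁ Y i) := by
  refine subsingleton_of_forall_eq 0 fun e => ?_
  obtain ⟨y, hy⟩ := Ext.contravariant_sequence_exact₁ hS Y e (add_comm 1 i) (Subsingleton.elim _ _)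
  rw [← hy, Subsingleton.elim y 0, Ext.comp_zero]

/-- The short complex of modules attached to an exact pair of linear maps. -/
abbrev shortComplexOfExact {A B C : Type u} [AddCommGroup A] [AddCommGroup B] [AddCommGroup C]
    [Module R A] [Module R B] [Module R C] {f : A →ₗ[R] B} {g : B →ₗ[R] C}
    (h : Function.Exact f g) : ShortComplex (ModuleCat.{u} R) :=
  ModuleCat.shortComplexOfCompEqZero f g h.linearMap_comp_eq_zero

theorem shortExact_shortComplexOfExact {A B C : Type u} [AddCommGroup A] [AddCommGroup B]
    [AddCommGroup C] [Module R A] [Module R B] [Module R C] {f : A →ₗ[R] B} {g : B →ₗ[R] C}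
    (h : Function.Exact f g) (hf : Function.Injective f) (hg : Function.Surjective g) :
    (shortComplexOfExact h).ShortExact where
  exact := ModuleCat.shortComplex_exact _ h
  mono_f := (ModuleCat.mono_iff_injective _).mpr hf
  epi_g := (ModuleCat.epi_iff_surjective _).mpr hg

theorem subsingleton_ext_prod {A B : Type u} [AddCommGroup A] [AddCommGroup B]
    [Module R A] [Module R B] (X : ModuleCat.{u} R) (i : ℕ)
    (hA : Subsingleton (Ext X (ModuleCat.of R A) i))
    (hB : Subsingleton (Ext X (ModuleCat.of R B) i)) :
    Subsingleton (Ext X (ModuleCat.of R (A × B)) i) :=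
  (shortExact_shortComplexOfExact (Function.Exact.inl_snd (R := R) (M := A) (N := B))
    LinearMap.inl_injective LinearMap.snd_surjective).subsingleton_ext_X₂ X i hA hB

theorem subsingleton_ext_zero_iff {X Y : Type u} [AddCommGroup X] [AddCommGroup Y]
    [Module R X] [Module R Y] :
    Subsingleton (Ext (ModuleCat.of R X) (ModuleCat.of R Y) 0) ↔ Subsingleton (X →ₗ[R] Y) :=
  (Ext.linearEquiv₀ (R := R).trans ModuleCat.homLinearEquiv).toEquiv.subsingleton_congr

theorem subsingleton_ext_congr {X Y : ModuleCat.{u} R} (Z : ModuleCat.{u} R) (e : X ≅ Y) (i : ℕ)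
    (h : Subsingleton (Ext X Z i)) : Subsingleton (Ext Y Z i) := by
  refine subsingleton_of_forall_eq 0 fun a => ?_
  have h1 : a = (Ext.mk₀ e.inv).comp ((Ext.mk₀ e.hom).comp a (zero_add i)) (zero_add i) := by simp
  rw [h1, Subsingleton.elim ((Ext.mk₀ e.hom).comp a (zero_add i)) 0, Ext.comp_zero]

theorem subsingleton_ext_congr_right {X Y : ModuleCat.{u} R} (Z : ModuleCat.{u} R) (e : X ≅ Y)
    (i : ℕ) (h : Subsingleton (Ext Z X i)) : Subsingleton (Ext Z Y i) := by
  refine subsingleton_of_forall_eq 0 fun a => ?_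
  have h1 : a = (a.comp (Ext.mk₀ e.inv) (add_zero i)).comp (Ext.mk₀ e.hom) (add_zero i) := by simp
  rw [h1, Subsingleton.elim (a.comp (Ext.mk₀ e.inv) (add_zero i)) 0, Ext.zero_comp]

theorem subsingleton_ext_quotSMulTop {N : Type u} [AddCommGroup N] [Module R N] {x : R}
    (hx : IsSMulRegular N x) (X : ModuleCat.{u} R) (i : ℕ)
    (h₀ : Subsingleton (Ext X (ModuleCat.of R N) i))
    (h₁ : Subsingleton (Ext X (ModuleCat.of R N) (i + 1))) :
    Subsingleton (Ext X (ModuleCat.of R (QuotSMulTop x N)) i) :=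
  (IsSMulRegular.smulShortComplex_shortExact (M := ModuleCat.of R N) hx).subsingleton_ext_X₃
    X i h₀ h₁

/-- An element that annihilates `X` acts as zero on every `Ext X N i`. -/
theorem ext_comp_smul_eq_zero {X N : ModuleCat.{u} R} {x : R}
    (hx : x ∈ Module.annihilator R X) {i : ℕ} (e : Ext X N i) :
    e.comp (Ext.mk₀ (ModuleCat.smulShortComplex N x).f) (add_zero i) = 0 := by
  have := congrArg (fun f => f.hom e) (Ext.postcomp_smul_id_eq_zero_of_mem_annihilator
    (M := N) (N := X) hx i)
  simpa using! this

/-- Multiplication by `x` is zero on `Ext(X, N)`, so every class in degree `i + 1` comes from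
`Ext^i(X, N/xN)` through the connecting map. -/
theorem subsingleton_ext_of_quotSMulTop {N : Type u} [AddCommGroup N] [Module R N] {x : R}
    (hx : IsSMulRegular N x) (X : ModuleCat.{u} R) (hX : x ∈ Module.annihilator R X) (i : ℕ)
    (h : Subsingleton (Ext X (ModuleCat.of R (QuotSMulTop x N)) i)) :
    Subsingleton (Ext X (ModuleCat.of R N) (i + 1)) := by
  refine subsingleton_of_forall_eq 0 fun e => ?_
  obtain ⟨y, hy⟩ := Ext.covariant_sequence_exact₁ X
    (IsSMulRegular.smulShortComplex_shortExact (M := ModuleCat.of R N) hx) e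
    (ext_comp_smul_eq_zero hX e) rfl
  have : y = 0 := h.elim _ _
  rw [← hy, this, Ext.zero_comp]
  rfl

end ExtVanishing

/-! ### Weakly regular sequences in exact sequences -/

section RegularSequences

variable {R : Type u} [CommRing R]

/-- Weak regularity passes to retracts. -/
theorem RingTheory.Sequence.IsWeaklyRegular.of_retract {A B : Type u} [AddCommGroup A]
    [AddCommGroup B] [Module R A] [Module R B] {i : A →ₗ[R] B} {p : B →ₗ[R] A}
    (h : p ∘ₗ i = LinearMap.id) {rs : List R} (hB : IsWeaklyRegular B rs) :
    IsWeaklyRegular A rs := by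
  induction rs generalizing A B with
  | nil => exact IsWeaklyRegular.nil R A
  | cons r rs ih =>
    rw [isWeaklyRegular_cons_iff] at hB ⊢
    refine ⟨fun a b hab => ?_, ih (i := QuotSMulTop.map r i) (p := QuotSMulTop.map r p) ?_ hB.2⟩
    · have hi : Function.Injective i :=
        Function.LeftInverse.injective (g := p) fun a => LinearMap.congr_fun h a
      refine hi (hB.1 ?_)
      simpa only [map_smul] using congrArg i hab
    · rw [← QuotSMulTop.map_comp, h, QuotSMulTop.map_id]

theorem exact_zero_of_injective {A B : Type u} [AddCommGroup A] [AddCommGroup B] [Module R A]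
    [Module R B] {f : A →ₗ[R] B} (hf : Function.Injective f) :
    Function.Exact (0 : PUnit.{u + 1} →ₗ[R] A) f := by
  rw [LinearMap.exact_iff, LinearMap.ker_eq_bot.mpr hf, LinearMap.range_zero]

/-- In a short exact sequence, a sequence that is weakly regular on the middle and the right term
is weakly regular on the left term. -/
theorem RingTheory.Sequence.IsWeaklyRegular.of_exact {A B C : Type u} [AddCommGroup A]
    [AddCommGroup B] [AddCommGroup C] [Module R A] [Module R B] [Module R C]
    {f : A →ₗ[R] B} {g : B →ₗ[R] C} (hf : Function.Injective f) (h : Function.Exact f g)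
    (hg : Function.Surjective g) {rs : List R} (hB : IsWeaklyRegular B rs)
    (hC : IsWeaklyRegular C rs) : IsWeaklyRegular A rs := by
  induction rs generalizing A B C with
  | nil => exact IsWeaklyRegular.nil R A
  | cons r rs ih =>
    rw [isWeaklyRegular_cons_iff] at hB hC ⊢
    refine ⟨fun a b hab => hf (hB.1 (by simpa only [map_smul] using congrArg f hab)),
      ih (f := QuotSMulTop.map r f) (g := QuotSMulTop.map r g) ?_
        (QuotSMulTop.map_exact r h hg) (QuotSMulTop.map_surjective r hg) hB.2 hC.2⟩
    -- Injectivity is encoded as exactness at `A` of `0 → A → B → C`. Regularity of `r` on `C` keeps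
    -- this exactness modulo `r`.
    have h0 := exact_zero_of_injective hf
    have := QuotSMulTop.map_first_exact_on_four_term_exact_of_isSMulRegular_last h0 h hC.1
    rw [injective_iff_map_eq_zero]
    intro a ha
    obtain ⟨b, rfl⟩ := (this a).mp ha
    obtain ⟨b, rfl⟩ := Submodule.mkQ_surjective _ b
    rw [Subsingleton.elim b 0]
    simp

/-- In a short exact sequence whose right term is weakly regular, the left term meets
`I • B` in `I • A`. -/
theorem mem_smul_top_of_exact_of_isWeaklyRegular {A B C : Type u} [AddCommGroup A]
    [AddCommGroup B] [AddCommGroup C] [Module R A] [Module R B] [Module R C]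
    {f : A →ₗ[R] B} {g : B →ₗ[R] C} (hf : Function.Injective f) (h : Function.Exact f g)
    (hg : Function.Surjective g) {rs : List R} (hC : IsWeaklyRegular C rs) {a : A}
    (ha : f a ∈ Ideal.ofList rs • (⊤ : Submodule R B)) :
    a ∈ Ideal.ofList rs • (⊤ : Submodule R A) := by
  have h0 := exact_zero_of_injective hf
  have := map_first_exact_on_four_term_right_exact_of_isSMulRegular_last h0 h hg hC
  obtain ⟨b, hb⟩ := (this (Submodule.Quotient.mk a)).mp
    (by simpa using! (Submodule.Quotient.mk_eq_zero _).mpr ha)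
  obtain ⟨b, rfl⟩ := Submodule.mkQ_surjective _ b
  rw [← Submodule.Quotient.mk_eq_zero, ← hb, Subsingleton.elim b 0]
  simp

/-- A finite free module inherits weakly regular sequences from the ring. -/
theorem RingTheory.Sequence.IsWeaklyRegular.pi {rs : List R} (h : IsWeaklyRegular R rs) (n : ℕ) :
    IsWeaklyRegular (Fin n → R) rs :=
  ((TensorProduct.rid R (Fin n → R)).isWeaklyRegular_congr rs).mp
    (h.isWeaklyRegular_lTensor (M₂ := Fin n → R))

theorem Function.Exact.subtype_range_rangeRestrict {A B C : Type u} [AddCommGroup A]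
    [AddCommGroup B] [AddCommGroup C] [Module R A] [Module R B] [Module R C]
    {f : A →ₗ[R] B} {g : B →ₗ[R] C} (h : Function.Exact f g) :
    Function.Exact (LinearMap.range f).subtype g.rangeRestrict := by
  rw [LinearMap.exact_iff, LinearMap.ker_rangeRestrict, Submodule.range_subtype]
  exact h.linearMap_ker_eq

end RegularSequences

/-! ### Socle elements acting on syzygies -/

section Syzygies

variable {R : Type u} [CommRing R] [IsLocalRing R] {M : Type u} [AddCommGroup M] [Module R M]

/-- The short exact sequence `0 → Ω (n + 1) → F n → Ω n → 0`. -/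
theorem MinimalFreeResolution.exists_exact_syzygy (F : MinimalFreeResolution R M) (n : ℕ) :
    ∃ (f : F.syzygy (n + 1) →ₗ[R] (Fin (F.rank n) → R))
      (g : (Fin (F.rank n) → R) →ₗ[R] F.syzygy n),
      Function.Injective f ∧ Function.Exact f g ∧ Function.Surjective g ∧
      LinearMap.range f ≤ IsLocalRing.maximalIdeal R • (⊤ : Submodule R (Fin (F.rank n) → R)) := by
  cases n with
  | zero =>
    refine ⟨(LinearMap.range (F.d 0)).subtype, F.aug.rangeRestrict, Subtype.val_injective, ?_,
      F.aug.surjective_rangeRestrict, ?_⟩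
    · exact F.exact_aug.subtype_range_rangeRestrict
    · exact (Submodule.range_subtype _).trans_le (F.minimal 0)
  | succ n =>
    refine ⟨(LinearMap.range (F.d (n + 1))).subtype, (F.d n).rangeRestrict, Subtype.val_injective,
      ?_, (F.d n).surjective_rangeRestrict, ?_⟩
    · exact (F.exact_d n).subtype_range_rangeRestrict
    · exact (Submodule.range_subtype _).trans_le (F.minimal (n + 1))

theorem MinimalFreeResolution.isWeaklyRegular_syzygy (F : MinimalFreeResolution R M) {rs : List R}
    (hR : IsWeaklyRegular R rs) (hM : IsWeaklyRegular M rs) (n : ℕ) :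
    IsWeaklyRegular (F.syzygy n) rs := by
  induction n with
  | zero =>
    exact ((LinearEquiv.ofTop _ (LinearMap.range_eq_top.mpr
      F.aug_surjective)).isWeaklyRegular_congr rs).mpr hM
  | succ n ih =>
    obtain ⟨f, g, hf, h, hg, -⟩ := F.exists_exact_syzygy n
    exact IsWeaklyRegular.of_exact hf h hg (hR.pi _) ih

/-- Elements that multiply the maximal ideal into `(rs)` multiply positive syzygies into
`(rs)` times themselves. -/
theorem MinimalFreeResolution.smul_mem_of_syzygy (F : MinimalFreeResolution R M) {rs : List R}
    (hR : IsWeaklyRegular R rs) (hM : IsWeaklyRegular M rs) {s : R}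
    (hs : ∀ a ∈ IsLocalRing.maximalIdeal R, s * a ∈ Ideal.ofList rs) {n : ℕ} (hn : 1 ≤ n)
    (w : F.syzygy n) : s • w ∈ Ideal.ofList rs • (⊤ : Submodule R (F.syzygy n)) := by
  obtain ⟨n, rfl⟩ := Nat.exists_eq_add_of_le' hn
  obtain ⟨f, g, hf, h, hg, hm⟩ := F.exists_exact_syzygy n
  refine mem_smul_top_of_exact_of_isWeaklyRegular hf h hg (F.isWeaklyRegular_syzygy hR hM n) ?_
  rw [map_smul]
  refine Submodule.smul_induction_on (hm (LinearMap.mem_range_self f w)) (fun a ha v _ => ?_)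
    fun v v' hv hv' => ?_
  · rw [smul_smul]
    exact Submodule.smul_mem_smul (hs a ha) trivial
  · rw [smul_add]
    exact add_mem hv hv'

/-- The condition that `s` maps a module into `(rs)` times itself passes to direct sums and
quotients. -/
theorem MinimalFreeResolution.smul_mem_of_surjective (F : MinimalFreeResolution R M) {rs : List R}
    (hR : IsWeaklyRegular R rs) (hM : IsWeaklyRegular M rs) {s : R}
    (hs : ∀ a ∈ IsLocalRing.maximalIdeal R, s * a ∈ Ideal.ofList rs)
    {r : ℕ} {n : Fin r → ℕ} (hn : ∀ i, 1 ≤ n i) {L : Type u} [AddCommGroup L] [Module R L]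
    {f : (⨁ i : Fin r, F.syzygy (n i)) →ₗ[R] L} (hf : Function.Surjective f) (l : L) :
    s • l ∈ Ideal.ofList rs • (⊤ : Submodule R L) := by
  obtain ⟨w, rfl⟩ := hf l
  induction w using DirectSum.induction_on with
  | zero => simp
  | of i w =>
    have h := Submodule.mem_map_of_mem
      (f := f ∘ₗ DirectSum.lof R (Fin r) (fun i => F.syzygy (n i)) i)
      (F.smul_mem_of_syzygy hR hM hs (hn i) w)
    rw [Submodule.map_smul'', map_smul] at h
    exact smul_mono_right (Ideal.ofList rs) (le_top (α := Submodule R L)) h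
  | add v w hv hw =>
    rw [map_add, smul_add]
    exact add_mem hv hw

end Syzygies

/-! ### Reducing `Hom(C, N)` modulo a regular sequence -/

section Semidualizing

variable {R : Type u} [CommRing R]

/-- If `Ext¹(C, N) = 0`, then maps from `C` lift along `N → N / xN`. -/
theorem exists_mkQ_comp_eq_of_subsingleton_ext {C N : Type u} [AddCommGroup C] [AddCommGroup N]
    [Module R C] [Module R N] {x : R} (hx : IsSMulRegular N x)
    (h : Subsingleton (Ext (ModuleCat.of R C) (ModuleCat.of R N) 1))
    (g : C →ₗ[R] QuotSMulTop x N) :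
    ∃ g' : C →ₗ[R] N, (x • (⊤ : Submodule R N)).mkQ ∘ₗ g' = g := by
  obtain ⟨y, hy⟩ := Ext.covariant_sequence_exact₃ (ModuleCat.of R C)
    (IsSMulRegular.smulShortComplex_shortExact (M := ModuleCat.of R N) hx)
    (Ext.mk₀ (ModuleCat.ofHom g)) (zero_add 1) (h.elim _ _)
  obtain ⟨y, rfl⟩ := Ext.homEquiv₀.symm.surjective y
  refine ⟨y.hom, ?_⟩
  have := (Ext.mk₀_bijective _ _).1 ((Ext.mk₀_comp_mk₀ _ _).symm.trans hy)
  exact congrArg ModuleCat.Hom.hom this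

/-- If `x` is regular on `N`, then `Hom(C, N) → Hom(C, N) → Hom(C, N / xN)` is exact, where the
first map is multiplication by `x`. -/
theorem exact_lsmul_compRight {C N : Type u} [AddCommGroup C] [AddCommGroup N]
    [Module R C] [Module R N] {x : R} (hx : IsSMulRegular N x) :
    Function.Exact (LinearMap.lsmul R (C →ₗ[R] N) x)
      (LinearMap.compRight R (M := C) (x • (⊤ : Submodule R N)).mkQ) := by
  intro g
  constructor
  · intro hg
    have h1 (c : C) : ∃ n : N, x • n = g c := by
      have := LinearMap.congr_fun hg c
      have := (Submodule.Quotient.mk_eq_zero _).mp this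
      obtain ⟨n, -, hn⟩ := (Submodule.mem_smul_pointwise_iff_exists _ _ _).mp this
      exact ⟨n, hn⟩
    choose f hf using h1
    refine ⟨⟨⟨f, fun a b => hx ?_⟩, fun r a => hx ?_⟩, ?_⟩
    · simp only [smul_add, hf, map_add]
    · simp only [hf, map_smul, smul_comm x r, RingHom.id_apply]
    · ext c
      exact hf c
  · rintro ⟨f, rfl⟩
    ext c
    exact (Submodule.Quotient.mk_eq_zero _).mpr
      (Submodule.smul_mem_pointwise_smul _ _ _ Submodule.mem_top)

/-- A map `C → N` with values in `(rs) N` lies in `(rs) Hom(C, N)`, if `rs` is weakly regular on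
`N` and the higher `Ext(C, N)` vanish. -/
theorem mem_ofList_smul_top_of_forall_mem {C N : Type u} [AddCommGroup C] [AddCommGroup N]
    [Module R C] [Module R N] {rs : List R} (hN : IsWeaklyRegular N rs)
    (h : ∀ i, 1 ≤ i → Subsingleton (Ext (ModuleCat.of R C) (ModuleCat.of R N) i))
    (g : C →ₗ[R] N) (hg : ∀ c, g c ∈ Ideal.ofList rs • (⊤ : Submodule R N)) :
    g ∈ Ideal.ofList rs • (⊤ : Submodule R (C →ₗ[R] N)) := by
  induction rs generalizing N with
  | nil =>
    have : g = 0 := by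
      ext c
      simpa using hg c
    simp [this]
  | cons x rs ih =>
    rw [isWeaklyRegular_cons_iff] at hN
    have hsurj : Function.Surjective
        (LinearMap.compRight R (M := C) (x • (⊤ : Submodule R N)).mkQ) :=
      exists_mkQ_comp_eq_of_subsingleton_ext hN.1 (h 1 le_rfl)
    have key := ih hN.2 (fun i hi => subsingleton_ext_quotSMulTop hN.1 _ i (h i hi)
      (h (i + 1) (hi.trans i.le_succ))) ((x • (⊤ : Submodule R N)).mkQ ∘ₗ g) fun c => by
        -- Modulo `x N`, the submodule `(x, rs) N` becomes `(rs) (N / xN)`, so the inductive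
        -- hypothesis applies to the reduction of `g`.
        have h1 := Submodule.mem_map_of_mem (f := (x • (⊤ : Submodule R N)).mkQ) (hg c)
        rw [Ideal.ofList_cons_smul, Submodule.map_sup, Submodule.map_smul'', Submodule.map_top,
          Submodule.range_mkQ, Submodule.mkQ_map_self, bot_sup_eq] at h1
        exact h1
    rw [← LinearMap.range_eq_top.mpr hsurj, ← Submodule.map_top, ← Submodule.map_smul''] at key
    -- Here `g'` is in `(rs) Hom(C, N)` and agrees with `g` modulo `x N`, so `g - g'` is `x` times a
    -- homomorphism.
    obtain ⟨g', hg', hgg'⟩ := key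
    have h2 : LinearMap.compRight R (M := C) (x • (⊤ : Submodule R N)).mkQ (g - g') = 0 := by
      rw [map_sub, hgg']
      exact sub_self _
    obtain ⟨e, he⟩ := (exact_lsmul_compRight hN.1 _).mp h2
    rw [Ideal.ofList_cons_smul, ← sub_add_cancel g g', ← he]
    exact Submodule.add_mem_sup (Submodule.smul_mem_pointwise_smul _ _ _ Submodule.mem_top) hg'

variable [IsLocalRing R]

theorem IsSimpleModule.nonempty_equiv_residueField (S : Type u) [AddCommGroup S] [Module R S]
    [IsSimpleModule R S] : Nonempty (S ≃ₗ[R] R ⧸ IsLocalRing.maximalIdeal R) := by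
  obtain ⟨I, hI, he⟩ := isSimpleModule_iff_quot_maximal.mp ‹IsSimpleModule R S›
  rwa [IsLocalRing.eq_maximalIdeal hI] at he

theorem exists_surjective_residueField (C : Type u) [AddCommGroup C] [Module R C]
    [Module.Finite R C] [Nontrivial C] :
    ∃ q : C →ₗ[R] (R ⧸ IsLocalRing.maximalIdeal R), Function.Surjective q := by
  obtain ⟨K, hK, -⟩ := (eq_top_or_exists_le_coatom (⊥ : Submodule R C)).resolve_left bot_ne_top
  have := isSimpleModule_iff_isCoatom.mpr hK
  obtain ⟨e⟩ := IsSimpleModule.nonempty_equiv_residueField (R := R) (C ⧸ K)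
  exact ⟨e.toLinearMap ∘ₗ K.mkQ, e.surjective.comp K.mkQ_surjective⟩

variable [IsNoetherianRing R]

/-- The depth of `Hom(C, N)` is at most that of `N` if the higher `Ext(C, N)` vanish. -/
theorem subsingleton_ext_residueField_of_linearMap {C N : Type u} [AddCommGroup C] [AddCommGroup N]
    [Module R C] [Module R N] [Module.Finite R C] [Nontrivial C] [Module.Finite R N]
    (h : ∀ i, 1 ≤ i → Subsingleton (Ext (ModuleCat.of R C) (ModuleCat.of R N) i)) (t : ℕ)
    (ht : ∀ i < t, Subsingleton (Ext (ModuleCat.of R (R ⧸ IsLocalRing.maximalIdeal R))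
      (ModuleCat.of R (C →ₗ[R] N)) i)) :
    ∀ i < t, Subsingleton (Ext (ModuleCat.of R (R ⧸ IsLocalRing.maximalIdeal R))
      (ModuleCat.of R N) i) := by
  induction t generalizing N with
  | zero => simp
  | succ t ih =>
    have h0 : Subsingleton ((R ⧸ IsLocalRing.maximalIdeal R) →ₗ[R] N) := by
      -- A map `k → N` precomposed with a surjection `C → k` is an element of `Hom(C, N)` killed by
      -- the maximal ideal. It vanishes because some `r` in that ideal is regular on `Hom(C, N)`.
      obtain ⟨r, hr, hreg⟩ := IsSMulRegular.subsingleton_linearMap_iff.mp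
        (subsingleton_ext_zero_iff.mp (ht 0 t.succ_pos))
      obtain ⟨q, hq⟩ := exists_surjective_residueField (R := R) C
      refine subsingleton_of_forall_eq 0 fun g => ?_
      have : g ∘ₗ q = 0 := hreg <| by
        ext c
        simp [← map_smul, Module.mem_annihilator.mp hr]
      ext
      obtain ⟨c, hc⟩ := hq 1
      simpa [hc] using! LinearMap.congr_fun this c
    obtain ⟨x, hxm, hx⟩ := IsSMulRegular.subsingleton_linearMap_iff.mp h0
    -- Vanishing of `Ext¹(C, N)` identifies `Hom(C, N)/x` with `Hom(C, N/xN)`, so both sides drop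
    -- one degree in the induction.
    have hse := shortExact_shortComplexOfExact (exact_lsmul_compRight (C := C) hx)
      (fun f g hfg => LinearMap.ext fun c => hx (LinearMap.congr_fun hfg c))
      (exists_mkQ_comp_eq_of_subsingleton_ext hx (h 1 le_rfl))
    have key := ih (N := QuotSMulTop x N)
      (fun i hi => subsingleton_ext_quotSMulTop hx _ i (h i hi) (h (i + 1) (hi.trans i.le_succ)))
      fun i hi => hse.subsingleton_ext_X₃ _ i (ht i (hi.trans t.lt_succ_self))
        (ht (i + 1) (Nat.succ_lt_succ hi))
    intro i hi
    cases i with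
    | zero => exact subsingleton_ext_zero_iff.mpr h0
    | succ i => exact subsingleton_ext_of_quotSMulTop hx _ hxm i (key i (Nat.lt_of_succ_lt_succ hi))

end Semidualizing

/-! ### Depth through `Ext` from the residue field -/

section Depth

variable {R : Type u} [CommRing R] [IsLocalRing R]

theorem maximalIdeal_smul_top_lt_top (N : Type u) [AddCommGroup N] [Module R N]
    [Module.Finite R N] [Nontrivial N] :
    IsLocalRing.maximalIdeal R • (⊤ : Submodule R N) < ⊤ :=
  lt_top_iff_ne_top.mpr (Submodule.top_ne_ideal_smul_of_le_jacobson_annihilator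
    (IsLocalRing.maximalIdeal_le_jacobson _)).symm

theorem support_quotient_maximalIdeal :
    Module.support R (R ⧸ IsLocalRing.maximalIdeal R) =
      PrimeSpectrum.zeroLocus (IsLocalRing.maximalIdeal R) := by
  rw [Module.support_eq_zeroLocus, Ideal.annihilator_quotient]

theorem exists_injective_of_isArtinian (N : Type u) [AddCommGroup N] [Module R N] [Nontrivial N]
    [IsArtinian R N] :
    ∃ ι : (R ⧸ IsLocalRing.maximalIdeal R) →ₗ[R] N, Function.Injective ι := by
  obtain ⟨K, hK, -⟩ := (eq_bot_or_exists_atom_le (⊤ : Submodule R N)).resolve_left top_ne_bot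
  have := isSimpleModule_iff_isAtom.mpr hK
  obtain ⟨e⟩ := IsSimpleModule.nonempty_equiv_residueField (R := R) K
  exact ⟨K.subtype ∘ₗ e.symm.toLinearMap, Subtype.val_injective.comp e.symm.injective⟩

variable [IsNoetherianRing R]

theorem subsingleton_ext_residueField_of_le_moduleDepth {N : Type u} [AddCommGroup N] [Module R N]
    [Module.Finite R N] {t : ℕ} (h : (t : ℕ∞) ≤ moduleDepth R N) :
    ∀ i < t, Subsingleton (Ext (ModuleCat.of R (R ⧸ IsLocalRing.maximalIdeal R))
      (ModuleCat.of R N) i) := by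
  intro i hi
  -- Depth is a supremum, so each `i` below it yields a regular sequence longer than `i`.
  have h1 : (i : ℕ∞) < moduleDepth R N := lt_of_lt_of_le (by exact_mod_cast hi) h
  simp only [moduleDepth, lt_iSup_iff] at h1
  obtain ⟨rs, hm, hreg, hlt⟩ := h1
  have := hreg.nontrivial
  exact ModuleCat.subsingleton_ext_of_exists_isRegular (IsLocalRing.maximalIdeal R) _
    support_quotient_maximalIdeal.subset (ModuleCat.of R N) (maximalIdeal_smul_top_lt_top N)
    rs hm hreg i (by exact_mod_cast hlt)

theorem exists_isRegular_of_subsingleton_ext_residueField {N : Type u} [AddCommGroup N]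
    [Module R N] [Module.Finite R N] [Nontrivial N] {t : ℕ}
    (h : ∀ i < t, Subsingleton (Ext (ModuleCat.of R (R ⧸ IsLocalRing.maximalIdeal R))
      (ModuleCat.of R N) i)) :
    ∃ rs : List R, rs.length = t ∧ (∀ r ∈ rs, r ∈ IsLocalRing.maximalIdeal R) ∧
      IsRegular N rs :=
  ModuleCat.exists_isRegular_of_exists_subsingleton_ext _ t (ModuleCat.of R N)
    (maximalIdeal_smul_top_lt_top N) _ support_quotient_maximalIdeal h

/-- One sequence serves all three modules because it is chosen regular on `R × M × N`, of which each
is a retract. Only weak regularity descends in general, as `M` or `N` could be zero. -/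
theorem exists_isWeaklyRegular_of_subsingleton_ext_residueField {M N : Type u} [AddCommGroup M]
    [Module R M] [Module.Finite R M] [AddCommGroup N] [Module R N] [Module.Finite R N] {t : ℕ}
    (hR : ∀ i < t, Subsingleton (Ext (ModuleCat.of R (R ⧸ IsLocalRing.maximalIdeal R))
      (ModuleCat.of R R) i))
    (hM : ∀ i < t, Subsingleton (Ext (ModuleCat.of R (R ⧸ IsLocalRing.maximalIdeal R))
      (ModuleCat.of R M) i))
    (hN : ∀ i < t, Subsingleton (Ext (ModuleCat.of R (R ⧸ IsLocalRing.maximalIdeal R))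
      (ModuleCat.of R N) i)) :
    ∃ rs : List R, rs.length = t ∧ (∀ r ∈ rs, r ∈ IsLocalRing.maximalIdeal R) ∧
      IsWeaklyRegular R rs ∧ IsWeaklyRegular M rs ∧ IsWeaklyRegular N rs := by
  obtain ⟨rs, hl, hm, h⟩ := exists_isRegular_of_subsingleton_ext_residueField
    (N := R × M × N) fun i hi =>
      subsingleton_ext_prod _ i (hR i hi) (subsingleton_ext_prod _ i (hM i hi) (hN i hi))
  have h2 : IsWeaklyRegular (M × N) rs :=
    h.toIsWeaklyRegular.of_retract (LinearMap.snd_comp_inr R R (M × N))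
  exact ⟨rs, hl, hm, h.toIsWeaklyRegular.of_retract (LinearMap.fst_comp_inl R R (M × N)),
    h2.of_retract (LinearMap.fst_comp_inl R M N), h2.of_retract (LinearMap.snd_comp_inr R M N)⟩

/-- A regular sequence of length `dim R` cuts the dimension to zero, so `R/(rs)` is an Artinian ring
over which the quotient is finite. -/
theorem isArtinian_quotient_ofList_smul_top {rs : List R} (hreg : IsRegular R rs)
    (hd : ringKrullDim R = rs.length) (N : Type u) [AddCommGroup N] [Module R N]
    [Module.Finite R N] : IsArtinian R (N ⧸ Ideal.ofList rs • (⊤ : Submodule R N)) := by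
  have h := ringKrullDim_add_length_eq_ringKrullDim_of_isRegular rs hreg
  have h0 : Ring.KrullDimLE 0 (R ⧸ Ideal.ofList rs) := by
    rw [Ring.krullDimLE_iff]
    rw [hd] at h
    generalize ringKrullDim (R ⧸ Ideal.ofList rs) = a at h
    induction a with
    | bot => exact bot_le
    | coe a =>
      have h1 : a + (rs.length : ℕ∞) = rs.length := by exact_mod_cast h
      have h2 : a = 0 := by
        have h3 : a ≠ ⊤ := by
          rintro rfl
          simp at h1
        lift a to ℕ using h3
        norm_cast at h1 ⊢
        omega
      simp [h2]
  have : IsArtinianRing (R ⧸ Ideal.ofList rs) :=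
    isArtinianRing_iff_isNoetherianRing_krullDimLE_zero.mpr ⟨inferInstance, h0⟩
  have : Module.Finite (R ⧸ Ideal.ofList rs) (N ⧸ Ideal.ofList rs • (⊤ : Submodule R N)) :=
    Module.Finite.of_restrictScalars_finite R _ _
  exact isArtinian_of_surjective_algebraMap (R := R ⧸ Ideal.ofList rs)
    Ideal.Quotient.mk_surjective

end Depth

/-! ### Finite injective dimension and extension of maps modulo a regular sequence -/

section InjectiveDimension

variable {R : Type u} [CommRing R]

/-- An extension class whose image under the connecting map extends along `f` does so itself. -/
theorem CategoryTheory.ShortComplex.ShortExact.exists_ext_comp_eq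
    {S : ShortComplex (ModuleCat.{u} R)} (hS : S.ShortExact) {X Y : ModuleCat.{u} R} {f : X ⟶ Y}
    {n : ℕ} (h : Subsingleton (Ext X S.X₂ n)) (a : Ext X S.X₃ n) (b : Ext Y S.X₁ (n + 1))
    (hb : (Ext.mk₀ f).comp b (zero_add _) = a.comp hS.extClass rfl)
    (hb0 : b.comp (Ext.mk₀ S.f) (add_zero _) = 0) :
    ∃ c : Ext Y S.X₃ n, (Ext.mk₀ f).comp c (zero_add n) = a := by
  obtain ⟨c, hc⟩ := Ext.covariant_sequence_exact₁ Y hS b hb0 rfl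
  refine ⟨c, sub_eq_zero.mp ?_⟩
  obtain ⟨z, hz⟩ := Ext.covariant_sequence_exact₃ X hS
    ((Ext.mk₀ f).comp c (zero_add _) - a) rfl (by
      rw [sub_eq_add_neg, Ext.add_comp, Ext.neg_comp, ← sub_eq_add_neg, sub_eq_zero,
        Ext.comp_assoc (Ext.mk₀ f) c hS.extClass (zero_add n) rfl (by simp), hc, hb])
  rw [← hz, Subsingleton.elim z 0, Ext.zero_comp]

/-- If precomposition with `ι : X → Y` is surjective on `Ext(-, N)` in degree the length of a
sequence that is weakly regular on `N`, kills `X` and `Y`, and in lower degrees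
`Ext(X, N)` vanishes, then maps `X → N / (rs) N` extend along `ι`. -/
theorem exists_comp_eq_of_forall_exists_ext_comp_eq {X Y N : Type u} [AddCommGroup X]
    [AddCommGroup Y] [AddCommGroup N] [Module R X] [Module R Y] [Module R N] (ι : X →ₗ[R] Y)
    {rs : List R} (hN : IsWeaklyRegular N rs) (hX : ∀ r ∈ rs, r ∈ Module.annihilator R X)
    (hY : ∀ r ∈ rs, r ∈ Module.annihilator R Y)
    (h0 : ∀ i < rs.length, Subsingleton (Ext (ModuleCat.of R X) (ModuleCat.of R N) i))
    (h : ∀ e : Ext (ModuleCat.of R X) (ModuleCat.of R N) rs.length,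
      ∃ e' : Ext (ModuleCat.of R Y) (ModuleCat.of R N) rs.length,
        (Ext.mk₀ (ModuleCat.ofHom ι)).comp e' (zero_add _) = e)
    (g : X →ₗ[R] N ⧸ Ideal.ofList rs • (⊤ : Submodule R N)) :
    ∃ g' : Y →ₗ[R] N ⧸ Ideal.ofList rs • (⊤ : Submodule R N), g' ∘ₗ ι = g := by
  induction rs generalizing N with
  | nil =>
    have e : (N ⧸ Ideal.ofList [] • (⊤ : Submodule R N)) ≃ₗ[R] N :=
      Submodule.quotEquivOfEqBot _ ((congrArg (· • ⊤) Ideal.ofList_nil).trans (Submodule.bot_smul ⊤))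
    obtain ⟨a, ha⟩ := h (Ext.mk₀ (ModuleCat.ofHom (e.toLinearMap ∘ₗ g)))
    obtain ⟨a, rfl⟩ := Ext.homEquiv₀.symm.surjective a
    have := (Ext.mk₀_bijective _ _).1 ((Ext.mk₀_comp_mk₀ _ _).symm.trans ha)
    have h1 : a.hom ∘ₗ ι = e.toLinearMap ∘ₗ g := congrArg ModuleCat.Hom.hom this
    refine ⟨e.symm.toLinearMap ∘ₗ a.hom, ?_⟩
    rw [LinearMap.comp_assoc, h1]
    ext
    simp
  | cons x rs ih =>
    rw [isWeaklyRegular_cons_iff] at hN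
    let e := Submodule.quotOfListConsSMulTopEquivQuotSMulTopInner N x rs
    have hse := IsSMulRegular.smulShortComplex_shortExact (M := ModuleCat.of R N) hN.1
    obtain ⟨g', hg'⟩ := ih hN.2 (fun r hr => hX r (List.mem_cons_of_mem x hr))
      (fun r hr => hY r (List.mem_cons_of_mem x hr))
      (fun i hi => subsingleton_ext_quotSMulTop hN.1 _ i (h0 i (Nat.lt_succ_of_lt hi))
        (h0 (i + 1) (Nat.succ_lt_succ hi)))
      (fun a => by
        -- The connecting map raises `a` to the degree where classes extend from `X` to `Y`. Since
        -- `x` kills `Y`, the extended class `b` comes back from `Ext(Y, N/xN)`.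
        obtain ⟨b, hb⟩ := h (Ext.comp a hse.extClass rfl)
        exact hse.exists_ext_comp_eq (h0 rs.length (Nat.lt_succ_self _)) a b hb
          (ext_comp_smul_eq_zero (hY x List.mem_cons_self) b))
      (e.toLinearMap ∘ₗ g)
    refine ⟨e.symm.toLinearMap ∘ₗ g', ?_⟩
    rw [LinearMap.comp_assoc, hg']
    ext
    simp

variable [IsLocalRing R]

/-- Dévissage along a composition series, whose factors are all the residue field. -/
theorem subsingleton_ext_of_isFiniteLength {L : ModuleCat.{u} R} {n : ℕ}
    (h : Subsingleton (Ext (ModuleCat.of R (R ⧸ IsLocalRing.maximalIdeal R)) L n))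
    {A : Type u} [AddCommGroup A] [Module R A] (hA : IsFiniteLength R A) :
    Subsingleton (Ext (ModuleCat.of R A) L n) := by
  induction hA with
  | @of_subsingleton A _ _ _ =>
    refine subsingleton_of_forall_eq 0 fun e => ?_
    rw [← Ext.mk₀_id_comp e, (ModuleCat.isZero_of_subsingleton _).eq_of_src (𝟙 _) 0, Ext.mk₀_zero,
      Ext.zero_comp]
  | @of_simple_quotient A _ _ N _ _ ih =>
    obtain ⟨e⟩ := IsSimpleModule.nonempty_equiv_residueField (R := R) (A ⧸ N)
    exact (shortExact_shortComplexOfExact (LinearMap.exact_subtype_mkQ N) N.subtype_injective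
      N.mkQ_surjective).subsingleton_ext_X₂_left L n ih
        (subsingleton_ext_congr L e.symm.toModuleIso n h)

variable [IsNoetherianRing R]

/-- Over a local ring with a regular sequence `rs` that has an Artinian quotient, a module of finite
injective dimension has no `Ext` from finite length modules above degree `rs.length`. -/
theorem subsingleton_ext_of_hasInjectiveDimensionLE {L : ModuleCat.{u} R} {N : ℕ}
    (hL : HasInjectiveDimensionLE L N) {rs : List R} (hreg : IsRegular R rs)
    (hart : IsArtinian R (R ⧸ Ideal.ofList rs)) {n : ℕ} (hn : rs.length < n)
    {A : Type u} [AddCommGroup A] [Module R A] (hA : IsFiniteLength R A) :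
    Subsingleton (Ext (ModuleCat.of R A) L n) := by
  have hpd : HasProjectiveDimensionLT (ModuleCat.of R (R ⧸ Ideal.ofList rs)) (rs.length + 1) := by
    have h1 := (ModuleCat.projectiveDimension_quotient_eq_length.{u} rs hreg).le
    rw [projectiveDimension_le_iff] at h1
    exact hasProjectiveDimensionLT_of_iso (Shrink.linearEquiv R _).toModuleIso _
  have : Nontrivial (R ⧸ Ideal.ofList rs) := Ideal.Quotient.nontrivial_iff.mpr fun h =>
    hreg.top_ne_smul (by simp [h])
  obtain ⟨ι, hι⟩ := exists_injective_of_isArtinian (R := R) (R ⧸ Ideal.ofList rs)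
  have hse := shortExact_shortComplexOfExact (LinearMap.exact_map_mkQ_range ι) hι
    (LinearMap.range ι).mkQ_surjective
  -- Descending induction on `n`, with `m` bounding the distance to `N + 1`, where the injective
  -- dimension gives vanishing. As `R/(rs)` has projective dimension `rs.length`, `Ext^n(k, L)` is
  -- controlled by `Ext^(n+1)` of the finite length cokernel of `k → R/(rs)`.
  have key (m : ℕ) : ∀ n, rs.length < n → N + 1 ≤ n + m →
      ∀ {A : Type u} [AddCommGroup A] [Module R A], IsFiniteLength R A →
        Subsingleton (Ext (ModuleCat.of R A) L n) := by
    induction m with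
    | zero => exact fun n _ h A _ _ _ => HasInjectiveDimensionLT.subsingleton L (N + 1) n h _
    | succ m ih =>
      intro n hn h A _ _ hA
      refine subsingleton_ext_of_isFiniteLength (hse.subsingleton_ext_X₁_left L n ?_ ?_) hA
      · exact HasProjectiveDimensionLT.subsingleton _ (rs.length + 1) n hn _
      · exact ih (n + 1) (by omega) (by omega)
          (isFiniteLength_iff_isNoetherian_isArtinian.mpr ⟨inferInstance, inferInstance⟩)
  exact key (N + 1) n hn (by omega) hA

end InjectiveDimension

/-! ### Faithfulness modulo a maximal regular sequence -/

section Socle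

variable {R : Type u} [CommRing R]

/-- A ring element that multiplies a nonzero free module into `I` times itself lies in `I`. -/
theorem mem_of_forall_smul_mem_of_free {L : Type u} [AddCommGroup L] [Module R L] [Nontrivial L]
    [Module.Free R L] {I : Ideal R} {s : R}
    (h : ∀ l : L, s • l ∈ I • (⊤ : Submodule R L)) : s ∈ I := by
  let b := Module.Free.chooseBasis R L
  obtain ⟨i⟩ := b.index_nonempty
  -- The coordinate at `b i` sends `s • b i` to `s` and `I • ⊤` into `I`.
  have h1 := Submodule.mem_map_of_mem (f := b.coord i) (h (b i))
  rw [Submodule.map_smul'', map_smul] at h1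
  have h2 := smul_mono_right I (le_top (a := Submodule.map (b.coord i) ⊤)) h1
  simpa using h2

/-- A ring element that multiplies a semidualizing module into `(rs)` times itself lies in
`(rs)`. -/
theorem IsSemidualizing.mem_of_forall_smul_mem {L : Type u} [AddCommGroup L] [Module R L]
    (hL : IsSemidualizing R L) {rs : List R} (hrs : IsWeaklyRegular L rs) {s : R}
    (h : ∀ l : L, s • l ∈ Ideal.ofList rs • (⊤ : Submodule R L)) : s ∈ Ideal.ofList rs := by
  have h1 := mem_ofList_smul_top_of_forall_mem hrs hL.ext_eq_zero (LinearMap.lsmul R L s) h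
  rw [← LinearMap.range_eq_top.mpr hL.homothety_bijective.2, ← Submodule.map_top,
    ← Submodule.map_smul''] at h1
  obtain ⟨s', hs', hss'⟩ := h1
  rw [← hL.homothety_bijective.1 hss']
  simpa using hs'

variable [IsLocalRing R] [IsNoetherianRing R]

/-- The homothety isomorphism `R ≅ Hom(L, L)` turns the depth comparison between `Hom(L, L)` and `L`
into one between `R` and `L`. -/
theorem IsSemidualizing.subsingleton_ext_residueField {L : Type u} [AddCommGroup L] [Module R L]
    [Nontrivial L] (hL : IsSemidualizing R L) (t : ℕ)
    (h : ∀ i < t, Subsingleton (Ext (ModuleCat.of R (R ⧸ IsLocalRing.maximalIdeal R))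
      (ModuleCat.of R R) i)) :
    ∀ i < t, Subsingleton (Ext (ModuleCat.of R (R ⧸ IsLocalRing.maximalIdeal R))
      (ModuleCat.of R L) i) := by
  have := hL.finite
  exact subsingleton_ext_residueField_of_linearMap hL.ext_eq_zero t fun i hi =>
    subsingleton_ext_congr_right _
      (LinearEquiv.ofBijective (LinearMap.lsmul R L) hL.homothety_bijective).toModuleIso i (h i hi)

/-- A regular sequence of length `dim R` has a socle element. -/
theorem exists_notMem_ofList_forall_mul_mem {rs : List R} (hreg : IsRegular R rs)
    (hd : ringKrullDim R = rs.length) :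
    ∃ s ∉ Ideal.ofList rs, ∀ a ∈ IsLocalRing.maximalIdeal R, s * a ∈ Ideal.ofList rs := by
  have := isArtinian_quotient_ofList_smul_top hreg hd R
  have : Nontrivial (R ⧸ Ideal.ofList rs • (⊤ : Submodule R R)) :=
    hreg.quot_ofList_smul_nontrivial ⊤
  obtain ⟨ι, hι⟩ := exists_injective_of_isArtinian (R := R)
    (R ⧸ Ideal.ofList rs • (⊤ : Submodule R R))
  have hmem (x : R) : Submodule.Quotient.mk (p := Ideal.ofList rs • (⊤ : Submodule R R)) x = 0 ↔
      x ∈ Ideal.ofList rs := by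
    rw [Submodule.Quotient.mk_eq_zero]
    simp
  obtain ⟨s, hs⟩ := Submodule.Quotient.mk_surjective _ (ι 1)
  refine ⟨s, fun h => ?_, fun a ha => (hmem _).mp ?_⟩
  · rw [← hmem, hs, map_eq_zero_iff ι hι] at h
    exact one_ne_zero h
  · have h1 : a • (1 : R ⧸ IsLocalRing.maximalIdeal R) = 0 := by
      rw [Algebra.smul_def, mul_one]
      exact Ideal.Quotient.eq_zero_iff_mem.mpr ha
    rw [mul_comm, ← smul_eq_mul, Submodule.Quotient.mk_smul, hs, ← map_smul, h1, map_zero]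

/-- Over a local ring with a maximal regular sequence `rs` that is also regular on a module `L` of
finite injective dimension, the socle of `R / (rs)` does not kill `L / (rs) L`. -/
theorem HasFiniteInjectiveDimension.exists_smul_notMem {L : Type u} [AddCommGroup L] [Module R L]
    [Module.Finite R L] [Nontrivial L] (hL : HasFiniteInjectiveDimension R L) {rs : List R}
    (hreg : IsRegular R rs) (hd : ringKrullDim R = rs.length)
    (hm : ∀ r ∈ rs, r ∈ IsLocalRing.maximalIdeal R) (hrs : IsWeaklyRegular L rs)
    {s : R} (hs : s ∉ Ideal.ofList rs)
    (hsm : ∀ a ∈ IsLocalRing.maximalIdeal R, s * a ∈ Ideal.ofList rs) :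
    ∃ l : L, s • l ∉ Ideal.ofList rs • (⊤ : Submodule R L) := by
  by_contra! hcon
  obtain ⟨N, hN⟩ := hL
  have hregL : IsRegular L rs := IsRegular.of_isWeaklyRegular_of_mem_maximalIdeal L hm hrs
  have hartR : IsArtinian R (R ⧸ Ideal.ofList rs) := by
    have := isArtinian_quotient_ofList_smul_top hreg hd R
    exact isArtinian_of_linearEquiv (Submodule.quotEquivOfEq _ _ (by simp) :
      (R ⧸ Ideal.ofList rs • (⊤ : Submodule R R)) ≃ₗ[R] R ⧸ Ideal.ofList rs)
  have := isArtinian_quotient_ofList_smul_top hreg hd L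
  have : Nontrivial (L ⧸ Ideal.ofList rs • (⊤ : Submodule R L)) :=
    hregL.quot_ofList_smul_nontrivial ⊤
  obtain ⟨g, hg⟩ := exists_injective_of_isArtinian (R := R)
    (L ⧸ Ideal.ofList rs • (⊤ : Submodule R L))
  -- Multiplication by the socle element `s`; it is nonzero since `s ∉ (rs)`, hence injective on the
  -- simple module `k`.
  let ι : (R ⧸ IsLocalRing.maximalIdeal R) →ₗ[R] R ⧸ Ideal.ofList rs :=
    Submodule.mapQ _ _ (LinearMap.lsmul R R s) hsm
  have hι1 : ι 1 = s • (1 : R ⧸ Ideal.ofList rs) := by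
    change Submodule.Quotient.mk (s • (1 : R)) = _
    rfl
  have hι : Function.Injective ι := by
    have : IsSimpleModule R (R ⧸ IsLocalRing.maximalIdeal R) :=
      isSimpleModule_iff_isCoatom.mpr (IsLocalRing.maximalIdeal.isMaximal R).out
    refine (LinearMap.injective_or_eq_zero ι).resolve_right fun h0 => hs ?_
    rw [h0, LinearMap.zero_apply, Algebra.smul_def, mul_one] at hι1
    exact Ideal.Quotient.eq_zero_iff_mem.mp hι1.symm
  have hse := shortExact_shortComplexOfExact (LinearMap.exact_map_mkQ_range ι) hι
    (LinearMap.range ι).mkQ_surjective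
  have hC : Subsingleton (Ext (ModuleCat.of R ((R ⧸ Ideal.ofList rs) ⧸ LinearMap.range ι))
      (ModuleCat.of R L) (rs.length + 1)) :=
    subsingleton_ext_of_hasInjectiveDimensionLE hN hreg hartR (Nat.lt_succ_self _)
      (isFiniteLength_iff_isNoetherian_isArtinian.mpr ⟨inferInstance, inferInstance⟩)
  obtain ⟨g', hg'⟩ := exists_comp_eq_of_forall_exists_ext_comp_eq ι hrs
    (fun r hr => by rw [Ideal.annihilator_quotient]; exact hm r hr)
    (fun r hr => by rw [Ideal.annihilator_quotient]; exact Ideal.subset_span hr)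
    (ModuleCat.subsingleton_ext_of_exists_isRegular (IsLocalRing.maximalIdeal R) _
      support_quotient_maximalIdeal.subset (ModuleCat.of R L) (maximalIdeal_smul_top_lt_top L)
      rs hm hregL)
    -- The obstruction to extending a class along `ι` lies in `Ext^(d+1)` of the cokernel of `ι`,
    -- which vanishes by `hC`.
    (fun e => Ext.contravariant_sequence_exact₁ hse _ e (add_comm 1 _) (hC.elim _ _)) g
  have h1 : g 1 = 0 := by
    rw [← hg', LinearMap.comp_apply, hι1, map_smul]
    obtain ⟨l, hl⟩ := Submodule.Quotient.mk_surjective _ (g' 1)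
    rw [← hl, ← Submodule.Quotient.mk_smul, Submodule.Quotient.mk_eq_zero]
    exact hcon l
  rw [map_eq_zero_iff g hg] at h1
  exact one_ne_zero h1

end Socle

/-! ### The socle element that kills `L` modulo a maximal regular sequence -/

section CohenMacaulay

variable {R : Type u} [CommRing R] [IsLocalRing R]

theorem IsMaximalCohenMacaulay.subsingleton_ext_residueField [IsNoetherianRing R] {M : Type u}
    [AddCommGroup M] [Module R M] (hM : IsMaximalCohenMacaulay R M) {t : ℕ}
    (ht : ringKrullDim R = t) :
    ∀ i < t, Subsingleton (Ext (ModuleCat.of R (R ⧸ IsLocalRing.maximalIdeal R))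
      (ModuleCat.of R M) i) := by
  have := hM.finite
  refine subsingleton_ext_residueField_of_le_moduleDepth ?_
  have h := hM.depth_eq.trans (hM.dim_eq.trans ht)
  exact (show moduleDepth R M = (t : ℕ∞) by exact_mod_cast h).ge

theorem IsCohenMacaulayLocal.subsingleton_ext_residueField [IsNoetherianRing R]
    (hR : IsCohenMacaulayLocal R) {t : ℕ} (ht : ringKrullDim R = t) :
    ∀ i < t, Subsingleton (Ext (ModuleCat.of R (R ⧸ IsLocalRing.maximalIdeal R))
      (ModuleCat.of R R) i) := by
  refine subsingleton_ext_residueField_of_le_moduleDepth ?_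
  have h := hR.depth_eq.trans ht
  exact (show moduleDepth R R = (t : ℕ∞) by exact_mod_cast h).ge

/-- Given a further module `N` of maximal depth and a quotient `L` of a direct sum of positive
syzygies of a maximal Cohen-Macaulay module, there is a sequence of length `dim R` that is regular
on `R` and `N`, and a socle element modulo that sequence which kills `L` modulo it. -/
theorem MinimalFreeResolution.exists_socle_smul_mem (hR : IsCohenMacaulayLocal R)
    {M : Type u} [AddCommGroup M] [Module R M] (hM : IsMaximalCohenMacaulay R M)
    (F : MinimalFreeResolution R M) {r : ℕ} (n : Fin r → ℕ) (hn : ∀ i, 1 ≤ n i)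
    {L : Type u} [AddCommGroup L] [Module R L]
    (f : (⨁ i : Fin r, F.syzygy (n i)) →ₗ[R] L) (hf : Function.Surjective f)
    {N : Type u} [AddCommGroup N] [Module R N] [Module.Finite R N] {d : ℕ}
    (hd : ringKrullDim R = d)
    (hN : ∀ i < d, Subsingleton (Ext (ModuleCat.of R (R ⧸ IsLocalRing.maximalIdeal R))
      (ModuleCat.of R N) i)) :
    ∃ rs : List R, IsRegular R rs ∧ ringKrullDim R = rs.length ∧
      (∀ r ∈ rs, r ∈ IsLocalRing.maximalIdeal R) ∧ IsWeaklyRegular N rs ∧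
      ∃ s ∉ Ideal.ofList rs, (∀ a ∈ IsLocalRing.maximalIdeal R, s * a ∈ Ideal.ofList rs) ∧
        ∀ l : L, s • l ∈ Ideal.ofList rs • (⊤ : Submodule R L) := by
  have := hR.noetherian
  have := hM.finite
  obtain ⟨rs, hl, hm, hrR, hrM, hrN⟩ := exists_isWeaklyRegular_of_subsingleton_ext_residueField
    (hR.subsingleton_ext_residueField hd) (hM.subsingleton_ext_residueField hd) hN
  have hreg := IsRegular.of_isWeaklyRegular_of_mem_maximalIdeal R hm hrR
  have hd' : ringKrullDim R = rs.length := by rw [hd, hl]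
  obtain ⟨s, hs, hsm⟩ := exists_notMem_ofList_forall_mul_mem hreg hd'
  exact ⟨rs, hreg, hd', hm, hrN, s, hs, hsm, F.smul_mem_of_surjective hrR hrM hsm hn hf⟩

end CohenMacaulay

theorem theorem3p3 {R : Type u} [CommRing R] [IsLocalRing R] (hR : IsCohenMacaulayLocal R)
    {M : Type u} [AddCommGroup M] [Module R M] (hM : IsMaximalCohenMacaulay R M)
    (F : MinimalFreeResolution R M)
    {r : ℕ} (n : Fin r → ℕ) (hn : ∀ i, 1 ≤ n i)
    {L : Type u} [AddCommGroup L] [Module R L] [Nontrivial L]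
    (f : (⨁ i : Fin r, F.syzygy (n i)) →ₗ[R] L) (hf : Function.Surjective f) :
    ¬ IsSemidualizing R L ∧
      ¬ Module.Free R L ∧
      ¬ (IsMaximalCohenMacaulay R L ∧ HasFiniteInjectiveDimension R L) := by
  have := hR.noetherian
  -- A Noetherian local ring has finite dimension.
  obtain ⟨d, hd⟩ : ∃ d : ℕ, ringKrullDim R = d := by
    obtain ⟨a, ha⟩ := WithBot.ne_bot_iff_exists.mp (ringKrullDim_ne_bot (R := R))
    have h : a ≠ ⊤ := fun h => ringKrullDim_ne_top (R := R) (by rw [← ha, h]; rfl)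
    obtain ⟨d, rfl⟩ := ENat.ne_top_iff_exists.mp h
    exact ⟨d, ha.symm⟩
  have hRd := hR.subsingleton_ext_residueField hd
  refine ⟨fun hL => ?_, fun hL => ?_, fun ⟨hL, hinj⟩ => ?_⟩
  · have := hL.finite
    obtain ⟨rs, -, -, -, hrs, s, hs, -, hsL⟩ := F.exists_socle_smul_mem hR hM n hn f hf hd
      (hL.subsingleton_ext_residueField d hRd)
    exact hs (hL.mem_of_forall_smul_mem hrs hsL)
  -- The free case needs no regularity on `L`, so the additional module is `R` itself.
  · obtain ⟨rs, -, -, -, -, s, hs, -, hsL⟩ := F.exists_socle_smul_mem hR hM n hn f hf hd hRd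
    exact hs (mem_of_forall_smul_mem_of_free hsL)
  · have := hL.finite
    obtain ⟨rs, hreg, hd', hm, hrs, s, hs, hsm, hsL⟩ := F.exists_socle_smul_mem hR hM n hn f hf hd
      (hL.subsingleton_ext_residueField hd)
    obtain ⟨l, hl⟩ := hinj.exists_smul_notMem hreg hd' hm hrs hs hsm
    exact hl (hsL l)
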